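/- Let $A$ be a (not necessarily bounded) self-adjoint operator on a complex Hilbert space $\mathcal H$, and let $V$ be a non-negative bounded self-adjoint operator on $\mathcal H$. Then $$\operatorname{spec}(A+V)\subset\operatorname{spec}(A)+[0,\|V\|],$$ where $A+V$ has the domain of $A$, and $\operatorname{spec}(A)+[0,\|V\|]:=\{\lambda+t \mid \lambda\in\operatorname{spec}(A),\ 0\le t\le\|V\|\}$. -/

import Mathlib

open scoped Pointwise

/-- The resolvent set of a (not necessarily bounded) linear operator `A : dom A → H` in a complex
normed space: all `z : ℂ` for which `A - z : dom A → H` is bijective with a bounded everywhere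
defined inverse `R`. -/
def LinearPMap.resolventSet {H : Type*} [NormedAddCommGroup H] [NormedSpace ℂ H]
    (A : H →ₗ.[ℂ] H) : Set ℂ :=
  {z | ∃ R : H →L[ℂ] H,
    (∀ y : H, ∃ h : R y ∈ A.domain, A ⟨R y, h⟩ - z • R y = y) ∧
    (∀ x : A.domain, R (A x - z • (x : H)) = x)}

/-- The spectrum of a (not necessarily bounded) linear operator: the complement in `ℂ` of its
resolvent set. -/
def LinearPMap.spec {H : Type*} [NormedAddCommGroup H] [NormedSpace ℂ H]
    (A : H →ₗ.[ℂ] H) : Set ℂ :=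
  A.resolventSetᶜ

/-- The sum `A + V` of an operator `A` and an everywhere defined bounded operator `V`, with domain
`dom A` and acting as `x ↦ A x + V x`. -/
def LinearPMap.addBounded {H : Type*} [NormedAddCommGroup H] [NormedSpace ℂ H]
    (A : H →ₗ.[ℂ] H) (V : H →L[ℂ] H) : H →ₗ.[ℂ] H where
  domain := A.domain
  toFun := A.toFun + (V : H →ₗ[ℂ] H).comp A.domain.subtype

open scoped InnerProductSpace

/-! The spectrum of `A + V` is real, since `A + V` is self-adjoint. If a real `a` lies outside the
right-hand side, then `[a - ‖V‖, a]` avoids the spectrum of `A`. Let `c = a - ‖V‖/2` be its midpoint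
and `R = (A - c)⁻¹`. As `R` is bounded self-adjoint, its norm is attained on its spectrum, so
`add_inv_mem_spec` gives `‖R‖ ‖V‖/2 < 1`. Positivity of `V` gives `‖V - ‖V‖/2‖ ≤ ‖V‖/2`. Hence in `A
+ V - a = (1 + (V - ‖V‖/2) R) (A - c)` the first factor is invertible by the Neumann series. -/

namespace LinearPMap

section NormedSpace

variable {H : Type*} [NormedAddCommGroup H] [NormedSpace ℂ H]

/-- Second resolvent identity, as a perturbation criterion: if `R` is the resolvent of `A` at `c`
and `1 + (V - s) R` is invertible, then `c + s` is in the resolvent set of `A + V`. -/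
lemma add_mem_resolventSet_addBounded {A : H →ₗ.[ℂ] H} {V R : H →L[ℂ] H} {c s : ℂ}
    (h₁ : ∀ y : H, ∃ h : R y ∈ A.domain, A ⟨R y, h⟩ - c • R y = y)
    (h₂ : ∀ x : A.domain, R (A x - c • (x : H)) = x)
    (hu : IsUnit (1 + (V - s • (1 : H →L[ℂ] H)) * R)) :
    c + s ∈ (A.addBounded V).resolventSet := by
  obtain ⟨u, hu⟩ := hu
  have hinv (y : H) : (↑u⁻¹ : H →L[ℂ] H) y
      + (V (R ((↑u⁻¹ : H →L[ℂ] H) y)) - s • R ((↑u⁻¹ : H →L[ℂ] H) y)) = y := by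
    have := DFunLike.congr_fun u.mul_inv y
    simpa [hu] using this
  refine ⟨R * ↑u⁻¹, fun y ↦ ?_, fun x ↦ ?_⟩
  · obtain ⟨hm, he⟩ := h₁ ((↑u⁻¹ : H →L[ℂ] H) y)
    refine ⟨hm, ?_⟩
    change A ⟨_, hm⟩ + V (R ((↑u⁻¹ : H →L[ℂ] H) y)) - (c + s) • R ((↑u⁻¹ : H →L[ℂ] H) y) = y
    rw [sub_eq_iff_eq_add.mp he]
    refine Eq.trans ?_ (hinv y)
    module
  · have key (x : A.domain) :
        R ((↑u⁻¹ : H →L[ℂ] H) (A x + V x - (c + s) • (x : H))) = x := by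
      have hux : (u : H →L[ℂ] H) (A x - c • (x : H)) = A x + V x - (c + s) • (x : H) := by
        rw [hu]
        change A x - c • (x : H) + (V (R (A x - c • (x : H))) - s • R (A x - c • (x : H))) = _
        rw [h₂ x]
        module
      have h : (↑u⁻¹ : H →L[ℂ] H) ((u : H →L[ℂ] H) (A x - c • (x : H))) = A x - c • (x : H) :=
        DFunLike.congr_fun u.inv_mul (A x - c • (x : H))
      rw [← hux, h, h₂]
    exact key x

/-- Spectral mapping for the resolvent `R = (A - c)⁻¹`: a nonzero point `μ` of its spectrum gives
the point `c + μ⁻¹` of the spectrum of `A`. -/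
lemma add_inv_mem_spec {A : H →ₗ.[ℂ] H} {R : H →L[ℂ] H} {c μ : ℂ}
    (h₁ : ∀ y : H, ∃ h : R y ∈ A.domain, A ⟨R y, h⟩ - c • R y = y)
    (h₂ : ∀ x : A.domain, R (A x - c • (x : H)) = x)
    (hμ : μ ≠ 0) (hR : μ ∈ spectrum ℂ R) : c + μ⁻¹ ∈ A.spec := by
  rintro ⟨S, hS₁, hS₂⟩
  refine hR ?_
  have hRS (y : H) : R (y + μ⁻¹ • S y) = S y := by
    obtain ⟨hm, he⟩ := hS₁ y
    refine Eq.trans (congrArg R ?_) (h₂ ⟨S y, hm⟩)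
    nth_rw 1 [← he]
    module
  have hSR (y : H) : S (y - μ⁻¹ • R y) = R y := by
    obtain ⟨hm, he⟩ := h₁ y
    refine Eq.trans (congrArg S ?_) (hS₂ ⟨R y, hm⟩)
    nth_rw 1 [← he]
    module
  -- Since `μ - R = μ (A - c - μ⁻¹) R`, the inverse must be `μ⁻¹ (A - c) S = μ⁻¹ (1 + μ⁻¹ S)`.
  refine ⟨⟨algebraMap ℂ _ μ - R, μ⁻¹ • (1 + μ⁻¹ • S), ContinuousLinearMap.ext fun y ↦ ?_,
    ContinuousLinearMap.ext fun y ↦ ?_⟩, rfl⟩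
  · change μ • (μ⁻¹ • (y + μ⁻¹ • S y)) - R (μ⁻¹ • (y + μ⁻¹ • S y)) = y
    rw [R.map_smul, hRS, smul_inv_smul₀ hμ, add_sub_cancel_right]
  · change μ⁻¹ • (μ • y - R y + μ⁻¹ • S (μ • y - R y)) = y
    have h : μ • y - R y = μ • (y - μ⁻¹ • R y) := by rw [smul_sub, smul_inv_smul₀ hμ]
    rw [h, S.map_smul, hSR, inv_smul_smul₀ hμ, ← h, sub_add_cancel, inv_smul_smul₀ hμ]

end NormedSpace

variable {H : Type*} [NormedAddCommGroup H] [InnerProductSpace ℂ H] [CompleteSpace H]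

lemma _root_.IsSelfAdjoint.isFormalAdjoint {A : H →ₗ.[ℂ] H} (hA : IsSelfAdjoint A) :
    A.IsFormalAdjoint A := by
  have := adjoint_isFormalAdjoint hA.dense_domain
  rwa [isSelfAdjoint_def.mp hA] at this

/-- A bounded self-adjoint perturbation of a self-adjoint operator is self-adjoint. -/
lemma isSelfAdjoint_addBounded {A : H →ₗ.[ℂ] H} (hA : IsSelfAdjoint A) {V : H →L[ℂ] H}
    (hV : (V : H →ₗ[ℂ] H).IsSymmetric) : IsSelfAdjoint (A.addBounded V) := by
  have hd : Dense ((A.addBounded V).domain : Set H) := hA.dense_domain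
  have hle : A.addBounded V ≤ (A.addBounded V).adjoint := by
    refine IsFormalAdjoint.le_adjoint hd fun (x : A.domain) (y : A.domain) ↦ ?_
    change ⟪A x + V x, (y : H)⟫_ℂ = ⟪(x : H), A y + V y⟫_ℂ
    rw [inner_add_left, inner_add_right, hA.isFormalAdjoint x y]
    congr 1
    exact hV x y
  refine (eq_of_le_of_domain_eq hle (le_antisymm hle.1 fun y hy ↦ ?_)).symm
  change y ∈ A.domain
  rw [← isSelfAdjoint_def.mp hA]
  refine mem_adjoint_domain_of_exists y ⟨(A.addBounded V).adjoint ⟨y, hy⟩ - V y, fun x ↦ ?_⟩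
  have h : ⟪(A.addBounded V).adjoint ⟨y, hy⟩, (x : H)⟫_ℂ = ⟪y, A x + V x⟫_ℂ :=
    adjoint_isFormalAdjoint hd ⟨y, hy⟩ x
  rw [inner_add_right] at h
  rw [inner_sub_left, h, sub_eq_iff_eq_add]
  congr 1
  exact (hV y x).symm

/-- The basic estimate `|Im z| ‖x‖ ≤ ‖(A - z) x‖`. -/
lemma abs_im_mul_norm_le {A : H →ₗ.[ℂ] H} (hA : IsSelfAdjoint A) (z : ℂ) (x : A.domain) :
    |z.im| * ‖(x : H)‖ ≤ ‖A x - z • (x : H)‖ := by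
  have him : (⟪(x : H), A x⟫_ℂ).im = 0 := by
    have h := hA.isFormalAdjoint x x
    rw [← inner_conj_symm] at h
    exact Complex.conj_eq_iff_im.mp h
  -- As `⟪x, A x⟫` is real, only `z` contributes to the imaginary part; Cauchy–Schwarz then gives
  -- the estimate.
  have h : |(⟪(x : H), A x - z • (x : H)⟫_ℂ).im| = |z.im| * ‖(x : H)‖ ^ 2 := by
    rw [inner_sub_right, inner_smul_right, inner_self_eq_norm_sq_to_K, Complex.sub_im, him,
      zero_sub, abs_neg]
    have : (z * ((‖(x : H)‖ : ℂ)) ^ 2).im = z.im * ‖(x : H)‖ ^ 2 := by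
      rw [← Complex.ofReal_pow, Complex.im_mul_ofReal]
    refine (congrArg abs this).trans ?_
    rw [abs_mul, abs_of_nonneg (sq_nonneg ‖(x : H)‖)]
  rcases (norm_nonneg (x : H)).eq_or_lt with h0 | h0
  · rw [← h0, mul_zero]; positivity
  · have := (Complex.abs_im_le_norm _).trans
      (norm_inner_le_norm (𝕜 := ℂ) (x : H) (A x - z • (x : H)))
    rw [h] at this
    refine le_of_mul_le_mul_left ?_ h0
    linarith

/-- The spectrum of a self-adjoint operator is real. -/
lemma mem_resolventSet_of_im_ne_zero {A : H →ₗ.[ℂ] H} (hA : IsSelfAdjoint A) {z : ℂ}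
    (hz : z.im ≠ 0) : z ∈ A.resolventSet := by
  have hz' : 0 < |z.im| := abs_pos.mpr hz
  -- On the graph, complete because `A` is closed, `A - z` becomes a bounded operator between Banach
  -- spaces.
  have : CompleteSpace A.graph := hA.isClosed.completeSpace_coe
  let B : A.graph →L[ℂ] H :=
    (ContinuousLinearMap.snd ℂ H H - z • ContinuousLinearMap.fst ℂ H H).comp A.graph.subtypeL
  have hB (p : A.graph) : B p = p.1.2 - z • p.1.1 := rfl
  have hbound (p : A.graph) : |z.im| * ‖p.1.1‖ ≤ ‖B p‖ := by
    obtain ⟨x, hx₁, hx₂⟩ := (mem_graph_iff A).mp p.2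
    rw [hB, ← hx₁, ← hx₂]
    exact abs_im_mul_norm_le hA z x
  have hanti : AntilipschitzWith (Real.toNNReal (1 + (1 + ‖z‖) / |z.im|)) B := by
    refine B.antilipschitz_of_bound fun p ↦ ?_
    rw [Real.coe_toNNReal _ (by positivity)]
    have h₁ : ‖p.1.1‖ ≤ ‖B p‖ / |z.im| := by
      rw [le_div_iff₀ hz', mul_comm]; exact hbound p
    have h₂ : ‖p.1.2‖ ≤ ‖B p‖ + ‖z‖ * ‖p.1.1‖ := by
      rw [← norm_smul]
      refine le_trans (le_of_eq ?_) (norm_add_le _ _)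
      rw [hB, sub_add_cancel]
    have h₃ : (1 + (1 + ‖z‖) / |z.im|) * ‖B p‖
        = ‖B p‖ + ‖B p‖ / |z.im| + ‖z‖ * (‖B p‖ / |z.im|) := by ring
    have h₄ := mul_le_mul_of_nonneg_left h₁ (norm_nonneg z)
    have h₅ : 0 ≤ ‖B p‖ / |z.im| := by positivity
    have h₆ : 0 ≤ ‖z‖ * (‖B p‖ / |z.im|) := by positivity
    rw [h₃]
    refine max_le ?_ ?_
    · change ‖p.1.1‖ ≤ _
      linarith [norm_nonneg (B p)]
    · change ‖p.1.2‖ ≤ _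
      linarith
  have hclosed : _root_.IsClosed (B.range : Set H) := by
    rw [LinearMap.coe_range]
    exact hanti.isClosed_range B.uniformContinuous
  -- A vector orthogonal to the range satisfies `A y = conj z • y`, because the adjoint of `A` is
  -- `A`; the basic estimate at `conj z` forces `y = 0`.
  have hdense : B.rangeᗮ = ⊥ := by
    rw [Submodule.eq_bot_iff]
    intro y hy
    have hy' (x : A.domain) : ⟪y, A x - z • (x : H)⟫_ℂ = 0 :=
      (Submodule.mem_orthogonal' _ _).mp hy _ ⟨⟨(x, A x), A.mem_graph x⟩, rfl⟩
    have hyA (x : A.domain) : ⟪(starRingEnd ℂ) z • y, (x : H)⟫_ℂ = ⟪y, A x⟫_ℂ := by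
      have h := hy' x
      rw [inner_sub_right, inner_smul_right, sub_eq_zero] at h
      rw [inner_smul_left, Complex.conj_conj, h]
    have hmem : y ∈ A.adjoint.domain := mem_adjoint_domain_of_exists y ⟨_, hyA⟩
    have heq : A.adjoint ⟨y, hmem⟩ = (starRingEnd ℂ) z • y :=
      adjoint_apply_eq hA.dense_domain ⟨y, hmem⟩ hyA
    have hgr : (y, (starRingEnd ℂ) z • y) ∈ A.graph := by
      rw [← isSelfAdjoint_def.mp hA, ← heq]
      exact A.adjoint.mem_graph ⟨y, hmem⟩
    obtain ⟨x, hx₁, hx₂⟩ := (mem_graph_iff A).mp hgr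
    have h := abs_im_mul_norm_le hA ((starRingEnd ℂ) z) x
    simp only at hx₁ hx₂
    rw [hx₁, hx₂, sub_self, norm_zero, Complex.conj_im, abs_neg] at h
    exact norm_le_zero_iff.mp (nonpos_of_mul_nonpos_right h hz')
  have hrange : B.range = ⊤ := by
    rw [← Submodule.topologicalClosure_eq_top_iff] at hdense
    rwa [hclosed.submodule_topologicalClosure_eq] at hdense
  let e := ContinuousLinearEquiv.ofBijective B (LinearMap.ker_eq_bot.mpr hanti.injective) hrange
  have he (p : A.graph) : e p = p.1.2 - z • p.1.1 := rfl
  refine ⟨(ContinuousLinearMap.fst ℂ H H).comp (A.graph.subtypeL.comp e.symm.toContinuousLinearMap),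
    fun y ↦ ?_, fun x ↦ ?_⟩
  · obtain ⟨x, hx₁, hx₂⟩ := (mem_graph_iff A).mp (e.symm y).2
    have hy := e.apply_symm_apply y
    rw [he, ← hx₁, ← hx₂] at hy
    change ∃ h : (e.symm y).1.1 ∈ A.domain, A ⟨(e.symm y).1.1, h⟩ - z • (e.symm y).1.1 = y
    rw [← hx₁]
    exact ⟨x.2, hy⟩
  · have h := e.symm_apply_apply ⟨(x, A x), A.mem_graph x⟩
    rw [he] at h
    change (e.symm (A x - z • (x : H))).1.1 = x
    rw [h]

/-- The resolvent of a self-adjoint operator at a real point is self-adjoint. -/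
lemma isSelfAdjoint_resolvent {A : H →ₗ.[ℂ] H} (hA : IsSelfAdjoint A) {R : H →L[ℂ] H} {c : ℝ}
    (h₁ : ∀ y : H, ∃ h : R y ∈ A.domain, A ⟨R y, h⟩ - (c : ℂ) • R y = y) :
    IsSelfAdjoint R := by
  rw [ContinuousLinearMap.isSelfAdjoint_iff_isSymmetric]
  intro x y
  change ⟪R x, y⟫_ℂ = ⟪x, R y⟫_ℂ
  obtain ⟨hx, hx'⟩ := h₁ x
  obtain ⟨hy, hy'⟩ := h₁ y
  nth_rw 2 [← hx']
  nth_rw 1 [← hy']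
  rw [inner_sub_left, inner_sub_right, inner_smul_left, inner_smul_right, Complex.conj_ofReal]
  congr 1
  exact (hA.isFormalAdjoint ⟨R x, hx⟩ ⟨R y, hy⟩).symm

end LinearPMap

/-- A positive operator `V` with `‖V‖ ≤ 2 r` is within distance `r` of the scalar `r`. -/
lemma ContinuousLinearMap.IsPositive.norm_sub_smul_one_le {H : Type*} [NormedAddCommGroup H]
    [InnerProductSpace ℂ H] [CompleteSpace H] {V : H →L[ℂ] H} (hV : V.IsPositive) {r : ℝ}
    (hr : ‖V‖ ≤ 2 * r) :
    ‖V - (r : ℂ) • (1 : H →L[ℂ] H)‖ ≤ r := by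
  have hsymm :
      ((V - (r : ℂ) • (1 : H →L[ℂ] H) : H →L[ℂ] H) : H →ₗ[ℂ] H).IsSymmetric := by
    intro x y
    change ⟪V x - (r : ℂ) • x, y⟫_ℂ = ⟪x, V y - (r : ℂ) • y⟫_ℂ
    rw [inner_sub_left, inner_sub_right, inner_smul_left, inner_smul_right, Complex.conj_ofReal]
    congr 1
    exact hV.1 x y
  have hr₀ : 0 ≤ r := by linarith [norm_nonneg V]
  -- For a symmetric operator the quadratic form determines the norm, and the shift by `r` moves its
  -- range on unit vectors from `[0, 2r]` into `[-r, r]`.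
  rw [ContinuousLinearMap.norm_eq_iSup_rayleighQuotient _ hsymm]
  refine ciSup_le fun x ↦ ?_
  have h₀ : 0 ≤ V.reApplyInnerSelf x := hV.2 x
  have h₁ : V.reApplyInnerSelf x ≤ 2 * r * ‖x‖ ^ 2 := by
    refine (Complex.re_le_norm _).trans ((norm_inner_le_norm _ _).trans ?_)
    grw [V.le_opNorm x, hr]
    exact le_of_eq (by ring)
  have h₂ : (V - (r : ℂ) • (1 : H →L[ℂ] H)).reApplyInnerSelf x
      = V.reApplyInnerSelf x - r * ‖x‖ ^ 2 := by
    change RCLike.re ⟪V x - (r : ℂ) • x, x⟫_ℂ = RCLike.re ⟪V x, x⟫_ℂ - r * ‖x‖ ^ 2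
    simp only [inner_sub_left,
      inner_smul_left, Complex.conj_ofReal, map_sub, inner_self_eq_norm_sq_to_K]
    congr 1
    refine (Complex.re_ofReal_mul _ _).trans ?_
    congr 1
    exact (congrArg Complex.re (Complex.ofReal_pow ‖x‖ 2).symm).trans (Complex.ofReal_re _)
  rw [ContinuousLinearMap.rayleighQuotient, h₂]
  refine abs_div _ _ |>.trans_le <| div_le_of_le_mul₀ (abs_nonneg _) (by positivity) ?_
  rw [abs_of_nonneg (sq_nonneg ‖x‖), abs_le]
  constructor <;> linarith

theorem corollary2p2 {H : Type*} [NormedAddCommGroup H] [InnerProductSpace ℂ H] [CompleteSpace H]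
    (A : H →ₗ.[ℂ] H) (hA : IsSelfAdjoint A)
    (V : H →L[ℂ] H) (hV : V.IsPositive) :
    (A.addBounded V).spec ⊆ A.spec + Complex.ofReal '' Set.Icc 0 ‖V‖ := by
  intro z hz
  have him : z.im = 0 := by
    by_contra h
    exact hz (LinearPMap.mem_resolventSet_of_im_ne_zero
      (LinearPMap.isSelfAdjoint_addBounded hA hV.1) h)
  obtain ⟨a, rfl⟩ : ∃ a : ℝ, (a : ℂ) = z := ⟨z.re, Complex.ext rfl him.symm⟩
  by_contra hnot
  have hfree (t : ℝ) (h₀ : 0 ≤ t) (h₁ : t ≤ ‖V‖) : ((a - t : ℝ) : ℂ) ∈ A.resolventSet := by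
    by_contra h
    exact hnot ⟨_, h, _, ⟨t, ⟨h₀, h₁⟩, rfl⟩, by push_cast; ring⟩
  have hr₀ : 0 ≤ ‖V‖ / 2 := by positivity
  obtain ⟨R, h₁, h₂⟩ := hfree (‖V‖ / 2) hr₀ (by linarith)
  have hRV : ‖R‖ * (‖V‖ / 2) < 1 := by
    by_contra! hle
    have hR : 0 < ‖R‖ := by
      refine lt_of_le_of_ne (norm_nonneg R) fun h ↦ ?_
      rw [← h] at hle
      linarith
    have hRinv : ‖R‖⁻¹ ≤ ‖V‖ / 2 := by
      rwa [inv_le_iff_one_le_mul₀' hR]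
    -- In the zero algebra the spectrum is empty, so the norm could not be attained there.
    have : Nontrivial (H →L[ℂ] H) := ⟨⟨R, 0, norm_pos_iff.mp hR⟩⟩
    obtain ⟨μ, hμ, hμR⟩ : ∃ μ : ℝ, |μ| = ‖R‖ ∧ μ ∈ spectrum ℝ R := by
      rcases CStarAlgebra.norm_or_neg_norm_mem_spectrum
        (LinearPMap.isSelfAdjoint_resolvent hA h₁) with h | h
      · exact ⟨_, abs_norm R, h⟩
      · exact ⟨_, by rw [abs_neg, abs_norm], h⟩
    have hμ₀ : (μ : ℂ) ≠ 0 := by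
      rw [← hμ] at hR
      exact_mod_cast abs_pos.mp hR
    rw [← hμ, ← abs_inv, abs_le] at hRinv
    refine LinearPMap.add_inv_mem_spec h₁ h₂ hμ₀ (spectrum.algebraMap_mem ℂ hμR) ?_
    -- `|μ⁻¹| ≤ ‖V‖/2` places `c + μ⁻¹` back in the interval `[a - ‖V‖, a]`, which is free of
    -- spectrum.
    convert hfree (‖V‖ / 2 - μ⁻¹) (by linarith) (by linarith) using 1
    push_cast
    ring
  refine hz ?_
  have hu : IsUnit (1 + (V - ((‖V‖ / 2 : ℝ) : ℂ) • (1 : H →L[ℂ] H)) * R) := by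
    rw [← sub_neg_eq_add]
    refine isUnit_one_sub_of_norm_lt_one ?_
    rw [norm_neg]
    calc _ ≤ _ := norm_mul_le _ _
      _ ≤ ‖V‖ / 2 * ‖R‖ := by gcongr; exact hV.norm_sub_smul_one_le (by linarith)
      _ < 1 := by rwa [mul_comm]
  have := LinearPMap.add_mem_resolventSet_addBounded h₁ h₂ hu
  rwa [← Complex.ofReal_add, sub_add_cancel] at this
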